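/- Let $T=\mathbb R/2\pi\mathbb Z$, let $C(T)$ be the space of continuous functions $f:T\to\mathbb C$ with $\|f\|=\max_{x\in T}|f(x)|$, and let $T_n$ be the space of trigonometric polynomials $\sum_{j=-n}^n c_je^{ijt}$, $c_j\in\mathbb C$. Put $E_n(f)=\inf_{\tau\in T_n}\|f-\tau\|$, $$\Delta_h^m f(x)=\sum_{i=0}^m(-1)^{m-i}\binom mi f\bigl(x-\tfrac m2h+ih\bigr),\qquad \omega_m(f,\delta)=\sup_{x\in T,\ |h|<\delta}|\Delta_h^mf(x)|.$$ For $m\ge1$ let $J_m$ be the Jackson--Stechkin constant, i.e. the infimum of all real $J$ such that $$E_n(f)\le J\,\omega_m\bigl(f,\tfrac{2\pi}n\bigr)\quad\text{for all } f\in C(T)\text{ and all integers } n\ge m.$$ **Corollary.** For every $m\ge1$ such constants $J$ exist and $J_m$ is the least of them. There is an absolute constant $C$ such that $$J_m\le C\,2^{-m+\frac52\log_2 m}\qquad\text{for all integers } m\ge1.$$ In particular $J_m\to0$ exponentially as $m\to\infty$: $\lim_{m\to\infty}J_m=0$, and there are $A\in\mathbb R$ and $q\in(0,1)$ with $J_m\le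 A\,q^m$ for all $m\ge1$. -/

import Mathlib

open Filter Topology

namespace JacksonStechkin

/-- The circle `T = ℝ / 2πℤ`. -/
abbrev Circ : Type := AddCircle (2 * Real.pi)

instance : Fact (0 < 2 * Real.pi) := ⟨Real.two_pi_pos⟩

/-- The space `T_n` of trigonometric polynomials `∑_{j=-n}^{n} c_j e^{ijt}` of degree at most `n`
(on the circle of length `2π`, `fourier j` is the function `t ↦ e^{ijt}`). -/
noncomputable def trigPoly (n : ℕ) : Submodule ℂ C(Circ, ℂ) :=
  Submodule.span ℂ {g | ∃ j : ℤ, |j| ≤ (n : ℤ) ∧ g = fourier j}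

/-- The best uniform approximation `E_n(f) = inf_{τ ∈ T_n} ‖f - τ‖`
(the norm on `C(Circ, ℂ)` is the maximum norm). -/
noncomputable def bestApprox (n : ℕ) (f : C(Circ, ℂ)) : ℝ :=
  ⨅ τ : trigPoly n, ‖f - (τ : C(Circ, ℂ))‖

/-- The central `m`-th difference
`Δ_h^m f(x) = ∑_{i=0}^m (-1)^{m-i} (m choose i) f(x - (m/2)h + ih)`. -/
noncomputable def centralDiff (m : ℕ) (h : ℝ) (f : C(Circ, ℂ)) (x : Circ) : ℂ :=
  ∑ i ∈ Finset.range (m + 1),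
    (-1 : ℂ) ^ (m - i) * (m.choose i : ℂ) *
      f (x + ((-((m : ℝ) / 2) * h + (i : ℝ) * h : ℝ) : Circ))

/-- The `m`-th modulus of smoothness `ω_m(f, δ) = sup_{x, |h| < δ} |Δ_h^m f(x)|`. -/
noncomputable def modulus (m : ℕ) (f : C(Circ, ℂ)) (δ : ℝ) : ℝ :=
  sSup {r | ∃ (x : Circ) (h : ℝ), |h| < δ ∧ r = ‖centralDiff m h f x‖}

/-- The constants `J` for which `E_n(f) ≤ J ω_m(f, 2π/n)` for all `f ∈ C(T)` and all `n ≥ m`. -/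
def admissible (m : ℕ) : Set ℝ :=
  {J | ∀ (f : C(Circ, ℂ)) (n : ℕ), m ≤ n →
    bestApprox n f ≤ J * modulus m f (2 * Real.pi / n)}

/-- The Jackson–Stechkin constant `J_m`, the best constant in the Jackson–Stechkin inequality. -/
noncomputable def jacksonConst (m : ℕ) : ℝ := sInf (admissible m)

end JacksonStechkin

/-! For even order `m = 2k`, the middle term of `Δ_w^{2k} f` is `± binom(2k, k) f`, while the other
terms are translates of `f` by `j w` with `j = i - k ≠ 0`. Averaging over `w = u + v` with `|u|, |v|
≤ h / 2` leaves the middle term intact and smooths the others. A Favard estimate, `E_n (∫_a^b f(· +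
u) du) ≤ π / (n + 1) * E_n f`, bounds the `j`-th smoothed term by `(π / ((n + 1) h))² j⁻² E_n f`.
One average would give only `1 / |j|`, whose sum is not bounded uniformly in `k`; two give `∑ 1 / j²
≤ π² / 3`. With `h` slightly below `2π / n` the smoothed terms contribute at most `23 / 25` of
`binom(2k, k) E_n f`, so they are absorbed: `binom(2k, k) E_n f ≤ 13 ω_{2k}`
(`centralBinom_mul_bestApprox_le`). As `binom(2k, k) ≥ 4^k / (2k)`, this is exponentially good; odd
orders follow from `ω_{m+1} ≤ 2 ω_m`.

The Favard estimate (`bestApprox_integral_trans_le`) is convolution with the sawtooth `(π - u) / 2`,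
so it reduces to `L¹` approximation of the sawtooth. The interpolant at the zeros of `sin ((n + 1)
x)` has error with the sign of that sine, and the sign function is orthogonal to `T_n`; the `L¹`
error is therefore an explicit integral. -/

namespace JacksonStechkin

/-! ### Interpolation of the sawtooth at Chebyshev nodes -/

open Polynomial Chebyshev Real in
lemma one_le_eval_U_and_le_succ {A : ℝ} (hA : 1 ≤ A) (n : ℕ) :
    1 ≤ (U ℝ n).eval A ∧ (U ℝ n).eval A ≤ (U ℝ (n + 1 : ℕ)).eval A := by
  induction n with
  | zero => simp; linarith
  | succ k ih =>
    obtain ⟨h1, h2⟩ := ih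
    refine ⟨h1.trans h2, ?_⟩
    have : U ℝ ((k + 1 + 1 : ℕ) : ℤ) = 2 * X * U ℝ ((k + 1 : ℕ) : ℤ) - U ℝ (k : ℤ) := by
      have := U_add_two ℝ (k : ℤ)
      push_cast at this ⊢
      rw [show (k : ℤ) + 1 + 1 = k + 2 by ring, this]
    rw [this]
    simp only [eval_sub, eval_mul, eval_ofNat, eval_X]
    nlinarith

/-- The zeros of the Chebyshev polynomial `U_n`. -/
noncomputable def node (n k : ℕ) : ℝ := Real.cos (((k : ℝ) + 1) * Real.pi / (n + 1))

lemma node_angle_mem {n k : ℕ} (hk : k ∈ Finset.range n) :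
    ((k : ℝ) + 1) * Real.pi / (n + 1) ∈ Set.Ioo 0 Real.pi := by
  have hk' : (k : ℝ) + 1 ≤ n := by exact_mod_cast Finset.mem_range.1 hk
  have := Real.pi_pos
  constructor
  · positivity
  · rw [div_lt_iff₀ (by positivity)]
    nlinarith

lemma node_injOn (n : ℕ) : Set.InjOn (node n) (Finset.range n : Set ℕ) := by
  intro i hi j hj h
  have := Real.injOn_cos (Set.Ioo_subset_Icc_self (node_angle_mem hi))
    (Set.Ioo_subset_Icc_self (node_angle_mem hj)) h
  have hpi := Real.pi_pos.ne'
  have hn : (n : ℝ) + 1 ≠ 0 := by positivity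
  field_simp at this
  exact_mod_cast add_right_cancel this

open Polynomial Chebyshev in
lemma eval_U_node {n k : ℕ} (hk : k ∈ Finset.range n) : (U ℝ n).eval (node n k) = 0 := by
  have h := node_angle_mem hk
  have h2 := U_real_cos (((k : ℝ) + 1) * Real.pi / (n + 1)) n
  have h3 : Real.sin ((((n : ℤ) : ℝ) + 1) * (((k : ℝ) + 1) * Real.pi / (n + 1))) = 0 := by
    rw [Real.sin_eq_zero_iff]
    refine ⟨k + 1, ?_⟩
    push_cast
    field_simp
  rw [h3] at h2
  exact (mul_eq_zero.1 h2).resolve_right (Real.sin_pos_of_pos_of_lt_pi h.1 h.2).ne'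

lemma node_abs_lt {n k : ℕ} (hk : k ∈ Finset.range n) : |node n k| < 1 := by
  have h := node_angle_mem hk
  have h1 := Real.sin_pos_of_pos_of_lt_pi h.1 h.2
  have h2 := Real.sin_sq_add_cos_sq (((k : ℝ) + 1) * Real.pi / (n + 1))
  rw [← sq_lt_one_iff_abs_lt_one]
  unfold node
  nlinarith [sq_pos_of_pos h1]

lemma one_add_sq_sub_pos {r y : ℝ} (hy : |y| < 1) : 0 < 1 + r ^ 2 - 2 * r * y := by
  have := (sq_lt_one_iff_abs_lt_one y).2 hy
  nlinarith [sq_nonneg (r - y)]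

open Polynomial Chebyshev in
/-- Interpolation of `y ↦ 1 / (1 + r² - 2ry)` at the zeros of `U_n`: the error is a nonnegative
multiple of `U_n`. -/
lemma interpolate_error_cauchy (n : ℕ) {r y : ℝ} (hr : 0 < r) (hr1 : r < 1) (hy : |y| < 1) :
    0 ≤ ((1 + r ^ 2 - 2 * r * y)⁻¹ - ∑ k ∈ Finset.range n,
      (1 + r ^ 2 - 2 * r * node n k)⁻¹ * (Lagrange.basis (Finset.range n) (node n) k).eval y) *
        (U ℝ n).eval y := by
  -- `A` is the pole of the kernel as a function of `y`; it lies outside `(-1, 1)`, where `U_n` is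
  -- at least `1`.
  set A : ℝ := (1 + r ^ 2) / (2 * r) with hA
  have hA1 : 1 ≤ A := by
    rw [hA, le_div_iff₀ (by positivity)]; nlinarith [sq_nonneg (1 - r)]
  have hU : 1 ≤ (U ℝ n).eval A := (one_le_eval_U_and_le_succ hA1 n).1
  have hD : ∀ z : ℝ, 1 + r ^ 2 - 2 * r * z = 2 * r * (A - z) := by
    intro z; rw [hA]; field_simp
  obtain ⟨Q, hQ⟩ : (X - C A) ∣ (U ℝ n - C ((U ℝ n).eval A)) := X_sub_C_dvd_sub_C_eval
  have hQe : ∀ z, (z - A) * Q.eval z = (U ℝ n).eval z - (U ℝ n).eval A := by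
    intro z
    have := congrArg (Polynomial.eval z) hQ
    simpa using this.symm
  have hUpos : (U ℝ n).eval A ≠ 0 := by linarith
  -- `P(y) = (1 - U_n(y) / U_n(A)) / (2r (A - y))` is the interpolant: the numerator vanishes at
  -- `A`, and equals `1` at the nodes.
  set P : ℝ[X] := C ((2 * r * (U ℝ n).eval A)⁻¹) * Q with hP
  have hdeg : P.degree < (Finset.range n).card := by
    rw [Finset.card_range]
    have h1 : P.degree ≤ Q.degree := by
      rw [hP, degree_C_mul (inv_ne_zero (by positivity))]
    refine h1.trans_lt ?_
    by_cases hQ0 : Q = 0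
    · rw [hQ0, degree_zero]; exact WithBot.bot_lt_coe _
    have h2 : ((X - C A) * Q).degree ≤ (n : WithBot ℕ) := by
      rw [← hQ]
      refine (degree_sub_le _ _).trans (max_le ?_ ?_)
      · exact (degree_U_natCast ℝ n).le
      · exact degree_C_le.trans (by exact_mod_cast Nat.zero_le n)
    rw [degree_mul, degree_X_sub_C, degree_eq_natDegree hQ0] at h2
    rw [degree_eq_natDegree hQ0]
    have : 1 + Q.natDegree ≤ n := by exact_mod_cast h2
    exact_mod_cast (by omega : Q.natDegree < n)
  have hnode : ∀ k ∈ Finset.range n, P.eval (node n k) = (1 + r ^ 2 - 2 * r * node n k)⁻¹ := by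
    intro k hk
    have h1 := hQe (node n k)
    rw [eval_U_node hk] at h1
    have h2 := one_add_sq_sub_pos (r := r) (node_abs_lt hk)
    have h3 : A - node n k ≠ 0 := by
      intro h; rw [hD, h] at h2; simp at h2
    rw [hD, hP]
    simp only [eval_mul, eval_C]
    have h4 : Q.eval (node n k) = (U ℝ n).eval A / (A - node n k) := by
      rw [eq_div_iff h3]; linarith
    rw [h4]
    field_simp
  have hint := Lagrange.eq_interpolate_of_eval_eq (fun k => (1 + r ^ 2 - 2 * r * node n k)⁻¹)
    (node_injOn n) hdeg hnode
  have hsum : ∑ k ∈ Finset.range n, (1 + r ^ 2 - 2 * r * node n k)⁻¹ *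
      (Lagrange.basis (Finset.range n) (node n) k).eval y = P.eval y := by
    conv_rhs => rw [hint, Lagrange.interpolate_apply]
    simp [eval_finsetSum]
  rw [hsum]
  have h2 := one_add_sq_sub_pos (r := r) hy
  have h3 : 0 < A - y := by
    rw [hD] at h2; exact pos_of_mul_pos_right h2 (by positivity)
  have h4 : Q.eval y = ((U ℝ n).eval A - (U ℝ n).eval y) / (A - y) := by
    rw [eq_div_iff h3.ne']; linarith [hQe y]
  have h5 : ((1 + r ^ 2 - 2 * r * y)⁻¹ - P.eval y) * (U ℝ n).eval y
      = ((U ℝ n).eval y) ^ 2 / (2 * r * (U ℝ n).eval A * (A - y)) := by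
    rw [hD, hP]
    simp only [eval_mul, eval_C]
    rw [h4]
    field_simp
    ring
  rw [h5]
  positivity

lemma continuous_inv_quadratic {y : ℝ} (hy : |y| < 1) :
    Continuous fun r : ℝ => (1 + r ^ 2 - 2 * r * y)⁻¹ :=
  Continuous.inv₀ (by fun_prop) fun _ => (one_add_sq_sub_pos hy).ne'

lemma abs_cos_lt_one {x : ℝ} (hx : x ∈ Set.Ioo 0 Real.pi) : |Real.cos x| < 1 := by
  rw [← sq_lt_one_iff_abs_lt_one]
  have h1 := Real.sin_pos_of_pos_of_lt_pi hx.1 hx.2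
  nlinarith [sq_pos_of_pos h1, Real.sin_sq_add_cos_sq x]

/-- Writes sawtooth over sine as a positive mixture of the kernels treated above, so the sign of the
interpolation error survives integration in `r`. The antiderivative is `arctan ((r - cos x) / sin x)
/ sin x`. -/
lemma integral_inv_quadratic {x : ℝ} (hx : x ∈ Set.Ioo 0 Real.pi) :
    ∫ r in (0 : ℝ)..1, (1 + r ^ 2 - 2 * r * Real.cos x)⁻¹
      = (Real.pi - x) / 2 / Real.sin x := by
  have hs := Real.sin_pos_of_pos_of_lt_pi hx.1 hx.2
  have hd : ∀ r ∈ Set.uIcc (0 : ℝ) 1,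
      HasDerivAt (fun r : ℝ => Real.arctan ((r - Real.cos x) / Real.sin x) / Real.sin x)
        ((1 + r ^ 2 - 2 * r * Real.cos x)⁻¹) r := by
    intro r _
    have h1 : HasDerivAt (fun r : ℝ => (r - Real.cos x) / Real.sin x) (1 / Real.sin x) r :=
      ((hasDerivAt_id r).sub_const _).div_const _
    have h2 := (h1.arctan).div_const (Real.sin x)
    refine h2.congr_deriv ?_
    have h3 := one_add_sq_sub_pos (r := r) (abs_cos_lt_one hx)
    have h4 : 1 + ((r - Real.cos x) / Real.sin x) ^ 2
        = (1 + r ^ 2 - 2 * r * Real.cos x) / Real.sin x ^ 2 := by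
      field_simp
      linarith [Real.sin_sq_add_cos_sq x]
    rw [h4]
    field_simp
  rw [intervalIntegral.integral_eq_sub_of_hasDerivAt hd
    ((continuous_inv_quadratic (abs_cos_lt_one hx)).intervalIntegrable _ _)]
  have e1 : Real.arctan ((1 - Real.cos x) / Real.sin x) = x / 2 := by
    rw [show (1 - Real.cos x) / Real.sin x = Real.tan (x / 2) from ?_, Real.arctan_tan]
    · linarith [hx.1, Real.pi_pos]
    · linarith [hx.2]
    · have hc : 0 < Real.cos (x / 2) :=
        Real.cos_pos_of_mem_Ioo ⟨by linarith [hx.1, Real.pi_pos], by linarith [hx.2]⟩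
      have hs2 : 0 < Real.sin (x / 2) :=
        Real.sin_pos_of_pos_of_lt_pi (by linarith [hx.1]) (by linarith [hx.2, hx.1])
      have hx2 : x = 2 * (x / 2) := by ring
      rw [Real.tan_eq_sin_div_cos]
      conv_lhs => rw [hx2, Real.sin_two_mul, Real.cos_two_mul]
      field_simp
      linarith [Real.sin_sq_add_cos_sq (x / 2)]
  have e2 : Real.arctan ((0 - Real.cos x) / Real.sin x) = x - Real.pi / 2 := by
    rw [show (0 - Real.cos x) / Real.sin x = Real.tan (x - Real.pi / 2) from ?_, Real.arctan_tan]
    · linarith [hx.1]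
    · linarith [hx.2]
    · rw [Real.tan_eq_sin_div_cos, Real.sin_sub_pi_div_two, Real.cos_sub_pi_div_two, zero_sub]
  rw [e1, e2]
  field_simp
  ring

open Polynomial Chebyshev in
/-- The odd trigonometric polynomial interpolating the sawtooth `(π - x) / 2` at the points
`kπ / (n + 1)`; the error has the sign of `sin ((n + 1) x)`. -/
lemma exists_saw_interpolant (n : ℕ) : ∃ p : ℝ[X], p.degree < n ∧ ∀ x ∈ Set.Ioo 0 Real.pi,
    0 ≤ ((Real.pi - x) / 2 - Real.sin x * p.eval (Real.cos x)) *
      Real.sin (((n : ℝ) + 1) * x) := by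
  set g : ℕ → ℝ := fun k => ∫ r in (0 : ℝ)..1, (1 + r ^ 2 - 2 * r * node n k)⁻¹ with hg
  refine ⟨Lagrange.interpolate (Finset.range n) (node n) g, ?_, ?_⟩
  · simpa using Lagrange.degree_interpolate_lt g (node_injOn n)
  · intro x hx
    have hs := Real.sin_pos_of_pos_of_lt_pi hx.1 hx.2
    have hy := abs_cos_lt_one hx
    have hU := U_real_cos x n
    rw [show (((n : ℤ) : ℝ) + 1) = (n : ℝ) + 1 by simp] at hU
    have key : 0 ≤ ((Real.pi - x) / 2 / Real.sin x -
        (Lagrange.interpolate (Finset.range n) (node n) g).eval (Real.cos x)) *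
          (U ℝ n).eval (Real.cos x) := by
      have h1 : (Lagrange.interpolate (Finset.range n) (node n) g).eval (Real.cos x)
          = ∫ r in (0 : ℝ)..1, ∑ k ∈ Finset.range n, (1 + r ^ 2 - 2 * r * node n k)⁻¹ *
            (Lagrange.basis (Finset.range n) (node n) k).eval (Real.cos x) := by
        rw [intervalIntegral.integral_finsetSum]
        · simp [Lagrange.interpolate_apply, eval_finsetSum, hg]
        · intro k hk
          exact ((continuous_inv_quadratic (node_abs_lt hk)).mul continuous_const).intervalIntegrable
            _ _
      rw [h1, ← integral_inv_quadratic hx, ← intervalIntegral.integral_sub,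
        ← intervalIntegral.integral_mul_const]
      · refine intervalIntegral.integral_nonneg_of_ae_restrict zero_le_one ?_
        rw [← MeasureTheory.restrict_Ioo_eq_restrict_Icc]
        filter_upwards [MeasureTheory.ae_restrict_mem measurableSet_Ioo] with r hr
        exact interpolate_error_cauchy n hr.1 hr.2 hy
      · exact (continuous_inv_quadratic hy).intervalIntegrable _ _
      · refine (continuous_finsetSum _ fun k hk => ?_).intervalIntegrable _ _
        exact (continuous_inv_quadratic (node_abs_lt hk)).mul continuous_const
    rw [← hU]
    -- One factor `sin x` clears the denominator, the other turns `U_n (cos x)` into `sin ((n + 1)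
    -- x)`.
    have := mul_nonneg key (sq_nonneg (Real.sin x))
    have e : Real.sin x * ((Real.pi - x) / 2 / Real.sin x) = (Real.pi - x) / 2 := by field_simp
    rw [← e]
    exact this.trans_eq (by ring)

/-! ### Trigonometric polynomials -/

lemma fourier_circ (j : ℤ) (u : ℝ) :
    (fourier j : C(Circ, ℂ)) (u : Circ) = Complex.exp (Complex.I * j * u) := by
  rw [fourier_coe_apply]
  congr 1
  have : (Real.pi : ℂ) ≠ 0 := by exact_mod_cast Real.pi_pos.ne'
  push_cast
  field_simp

lemma fourier_mem_trigPoly {n : ℕ} {j : ℤ} (hj : |j| ≤ n) :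
    (fourier j : C(Circ, ℂ)) ∈ trigPoly n :=
  Submodule.subset_span ⟨j, hj, rfl⟩

lemma trigPoly_mono {a b : ℕ} (h : a ≤ b) : trigPoly a ≤ trigPoly b := by
  refine Submodule.span_mono ?_
  rintro g ⟨j, hj, rfl⟩
  exact ⟨j, hj.trans (by exact_mod_cast h), rfl⟩

lemma mul_mem_trigPoly {a b : ℕ} {f g : C(Circ, ℂ)} (hf : f ∈ trigPoly a) (hg : g ∈ trigPoly b) :
    f * g ∈ trigPoly (a + b) := by
  have h : trigPoly a * trigPoly b ≤ trigPoly (a + b) := by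
    unfold trigPoly
    rw [Submodule.span_mul_span]
    refine Submodule.span_mono ?_
    rintro _ ⟨_, ⟨i, hi, rfl⟩, _, ⟨j, hj, rfl⟩, rfl⟩
    refine ⟨i + j, (abs_add_le i j).trans ?_, ?_⟩
    · push_cast; exact add_le_add hi hj
    · ext x; simp
  exact h (Submodule.mul_mem_mul hf hg)

lemma exists_trigPoly_cos : ∃ T ∈ trigPoly 1, ∀ u : ℝ, T (u : Circ) = (Real.cos u : ℂ) := by
  refine ⟨(1 / 2 : ℂ) • (fourier 1 + fourier (-1)), Submodule.smul_mem _ _ (Submodule.add_mem _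
    (fourier_mem_trigPoly (by simp)) (fourier_mem_trigPoly (by simp))), fun u => ?_⟩
  simp only [ContinuousMap.smul_apply, ContinuousMap.add_apply, fourier_circ, Complex.ofReal_cos,
    Complex.cos, smul_eq_mul]
  push_cast
  ring_nf

lemma exists_trigPoly_sin : ∃ T ∈ trigPoly 1, ∀ u : ℝ, T (u : Circ) = (Real.sin u : ℂ) := by
  refine ⟨(Complex.I / 2 : ℂ) • (fourier (-1) - fourier 1), Submodule.smul_mem _ _
    (Submodule.sub_mem _ (fourier_mem_trigPoly (by simp)) (fourier_mem_trigPoly (by simp))),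
    fun u => ?_⟩
  simp only [ContinuousMap.smul_apply, ContinuousMap.sub_apply, fourier_circ, Complex.ofReal_sin,
    Complex.sin, smul_eq_mul]
  push_cast
  ring_nf

open Polynomial in
lemma exists_trigPoly_sin_mul_eval_cos {n : ℕ} {p : ℝ[X]} (hp : p.degree < n) :
    ∃ T ∈ trigPoly n, ∀ u : ℝ,
      T (u : Circ) = ((Real.sin u * p.eval (Real.cos u) : ℝ) : ℂ) := by
  obtain ⟨S, hS, hSu⟩ := exists_trigPoly_sin
  obtain ⟨K, hK, hKu⟩ := exists_trigPoly_cos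
  have hpow : ∀ i : ℕ, K ^ i ∈ trigPoly i := by
    intro i
    induction i with
    | zero =>
      have : (1 : C(Circ, ℂ)) = fourier 0 := by ext x; simp
      rw [pow_zero, this]
      exact fourier_mem_trigPoly (by simp)
    | succ k ih => rw [pow_succ]; exact mul_mem_trigPoly ih hK
  refine ⟨∑ i ∈ Finset.range n, (p.coeff i : ℂ) • (S * K ^ i), ?_, fun u => ?_⟩
  · refine Submodule.sum_mem _ fun i hi => Submodule.smul_mem _ _ ?_
    refine trigPoly_mono ?_ (mul_mem_trigPoly hS (hpow i))
    have := Finset.mem_range.1 hi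
    omega
  · have he : p.eval (Real.cos u) = ∑ i ∈ Finset.range n, p.coeff i * Real.cos u ^ i := by
      by_cases h0 : p = 0
      · simp [h0]
      · exact eval_eq_sum_range' ((natDegree_lt_iff_degree_lt h0).2 hp) _
    rw [he, Finset.mul_sum]
    simp only [ContinuousMap.sum_apply, ContinuousMap.smul_apply, ContinuousMap.mul_apply,
      ContinuousMap.pow_apply, hSu, hKu, smul_eq_mul]
    push_cast
    exact Finset.sum_congr rfl fun i _ => by ring

/-! ### The square wave and `L¹` approximation of the sawtooth -/

/-- The square wave `sign (sin ((n + 1) u))`. -/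
noncomputable def squareWave (n : ℕ) (u : ℝ) : ℝ :=
  Real.sin (((n : ℝ) + 1) * u) / |Real.sin (((n : ℝ) + 1) * u)|

lemma measurable_squareWave (n : ℕ) : Measurable (squareWave n) := by
  unfold squareWave
  fun_prop

lemma abs_squareWave_le (n : ℕ) (u : ℝ) : |squareWave n u| ≤ 1 := by
  unfold squareWave
  rw [abs_div, abs_abs]
  exact div_self_le_one _

lemma squareWave_shift (n : ℕ) (u : ℝ) :
    squareWave n (u + Real.pi / (n + 1)) = -squareWave n u := by
  have : ((n : ℝ) + 1) * (u + Real.pi / (n + 1)) = ((n : ℝ) + 1) * u + Real.pi := by field_simp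
  unfold squareWave
  rw [this, Real.sin_add_pi, abs_neg, neg_div]

lemma squareWave_periodic (n : ℕ) : Function.Periodic (squareWave n) (2 * Real.pi) := by
  intro u
  have : ((n : ℝ) + 1) * (u + 2 * Real.pi) = ((n : ℝ) + 1) * u + (n + 1 : ℕ) * (2 * Real.pi) := by
    push_cast; ring
  unfold squareWave
  rw [this, Real.sin_add_nat_mul_two_pi]

lemma intervalIntegrable_mul_squareWave (n : ℕ) {g : ℝ → ℝ} (hg : Continuous g) (a b : ℝ) :
    IntervalIntegrable (fun u => g u * squareWave n u) MeasureTheory.volume a b := by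
  refine (hg.intervalIntegrable a b).mono_fun
    ((hg.measurable.mul (measurable_squareWave n)).aestronglyMeasurable) ?_
  refine Filter.Eventually.of_forall fun u => ?_
  simp only [norm_mul, Real.norm_eq_abs]
  exact mul_le_of_le_one_right (abs_nonneg _) (abs_squareWave_le n u)

/-- Shifting by `c = π / (n + 1)` multiplies the integrand by `-e^{ijc}` but preserves the integral
over a period. That factor is not `1`, since `e^{ijc} = -1` would make `j` an odd multiple of `n +
1`. -/
lemma integral_fourier_mul_squareWave {n : ℕ} {j : ℤ} (hj : |j| ≤ n) :
    ∫ u in (0 : ℝ)..(2 * Real.pi), (fourier j : C(Circ, ℂ)) (u : Circ) * (squareWave n u : ℂ)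
      = 0 := by
  set c : ℝ := Real.pi / (n + 1) with hc
  set F : ℝ → ℂ := fun u => (fourier j : C(Circ, ℂ)) (u : Circ) * (squareWave n u : ℂ) with hF
  have hper : Function.Periodic F (2 * Real.pi) := by
    intro u
    simp only [hF]
    rw [squareWave_periodic n u, AddCircle.coe_add_period]
  have hshift : ∀ u, F (u + c) = -Complex.exp (Complex.I * j * c) * F u := by
    intro u
    simp only [hF, fourier_circ, hc]
    rw [squareWave_shift]
    push_cast
    rw [mul_add, Complex.exp_add]
    ring
  have h1 : ∫ u in (0 : ℝ)..(2 * Real.pi), F (u + c) = ∫ u in (0 : ℝ)..(2 * Real.pi), F u := by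
    rw [intervalIntegral.integral_comp_add_right, zero_add, add_comm (2 * Real.pi) c,
      hper.intervalIntegral_add_eq c 0, zero_add]
  simp_rw [hshift] at h1
  rw [intervalIntegral.integral_const_mul] at h1
  have h2 : Complex.exp (Complex.I * j * c) ≠ -1 := by
    intro h
    rw [← Complex.exp_pi_mul_I, Complex.exp_eq_exp_iff_exists_int] at h
    obtain ⟨k, hk⟩ := h
    have hI := Complex.I_ne_zero
    have hpi : (Real.pi : ℂ) ≠ 0 := by exact_mod_cast Real.pi_pos.ne'
    have hn : (n : ℂ) + 1 ≠ 0 := by exact_mod_cast Nat.succ_ne_zero n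
    have h3 : (j : ℂ) = (n + 1) * (1 + 2 * k) := by
      rw [hc] at hk
      push_cast at hk
      field_simp at hk
      linear_combination hk
    have h4 : j = (n + 1) * (1 + 2 * k) := by exact_mod_cast h3
    have h5 : 1 ≤ |1 + 2 * k| := Int.one_le_abs (by omega)
    rw [h4, abs_mul, abs_of_nonneg (by positivity)] at hj
    nlinarith
  have h3 : (Complex.exp (Complex.I * j * c) + 1) * ∫ u in (0 : ℝ)..(2 * Real.pi), F u = 0 := by
    linear_combination -h1
  exact (mul_eq_zero.1 h3).resolve_left fun h => h2 (eq_neg_of_add_eq_zero_left h)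

lemma integral_trigPoly_mul_squareWave {n : ℕ} {T : C(Circ, ℂ)} (hT : T ∈ trigPoly n) :
    ∫ u in (0 : ℝ)..(2 * Real.pi), T (u : Circ) * (squareWave n u : ℂ) = 0 := by
  have hint : ∀ T : C(Circ, ℂ), IntervalIntegrable
      (fun u : ℝ => T (u : Circ) * (squareWave n u : ℂ)) MeasureTheory.volume 0 (2 * Real.pi) := by
    intro T
    have hc : Continuous fun u : ℝ => T (u : Circ) := by
      have : Continuous ((↑) : ℝ → Circ) := AddCircle.continuous_mk' _
      fun_prop
    refine (hc.intervalIntegrable _ _).mono_fun ((hc.measurable.mul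
      (Complex.measurable_ofReal.comp (measurable_squareWave n))).aestronglyMeasurable) ?_
    refine Filter.Eventually.of_forall fun u => ?_
    simp only [norm_mul, Complex.norm_real, Real.norm_eq_abs]
    exact mul_le_of_le_one_right (norm_nonneg _) (abs_squareWave_le n u)
  induction hT using Submodule.span_induction with
  | mem x h =>
    obtain ⟨j, hj, rfl⟩ := h
    exact integral_fourier_mul_squareWave hj
  | zero => simp
  | add x y _ _ hx hy =>
    simp only [ContinuousMap.add_apply, add_mul]
    rw [intervalIntegral.integral_add (hint x) (hint y), hx, hy, add_zero]
  | smul a x _ hx =>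
    simp only [ContinuousMap.smul_apply, smul_eq_mul, mul_assoc]
    rw [intervalIntegral.integral_const_mul, hx, mul_zero]

lemma integral_squareWave (n : ℕ) (a : ℝ) :
    ∫ u in a..(a + 2 * Real.pi), squareWave n u = 0 := by
  rw [(squareWave_periodic n).intervalIntegral_add_eq a 0, zero_add]
  have h := integral_fourier_mul_squareWave (n := n) (j := 0) (by simp)
  simp only [fourier_zero, one_mul] at h
  rw [intervalIntegral.integral_ofReal] at h
  exact_mod_cast h

/-- The same shift gives two expressions for the first moment `G` of the square wave. Comparing them
yields `G = π ∫_{-c}^0 squareWave`, of modulus at most `π c`. -/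
lemma integral_saw_mul_squareWave_le (n : ℕ) :
    ∫ u in (0 : ℝ)..(2 * Real.pi), (Real.pi - u) / 2 * squareWave n u
      ≤ Real.pi ^ 2 / (2 * (n + 1)) := by
  set c : ℝ := Real.pi / (n + 1) with hc
  have hc0 : 0 ≤ c := by positivity
  have hid : ∀ a b, IntervalIntegrable (fun u => u * squareWave n u) MeasureTheory.volume a b :=
    fun a b => intervalIntegrable_mul_squareWave n continuous_id a b
  have hone : ∀ a b, IntervalIntegrable (squareWave n) MeasureTheory.volume a b := fun a b => by
    simpa using intervalIntegrable_mul_squareWave n (continuous_const (y := (1 : ℝ))) a b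
  set G := ∫ u in (0 : ℝ)..(2 * Real.pi), u * squareWave n u with hG
  have h1 : G = -∫ u in (-c)..(-c + 2 * Real.pi), u * squareWave n u := by
    have e : G = ∫ u in (-c)..(-c + 2 * Real.pi), (u + c) * squareWave n (u + c) := by
      rw [intervalIntegral.integral_comp_add_right (fun u => u * squareWave n u) c, hG]
      congr 1 <;> ring
    rw [e]
    simp_rw [hc, squareWave_shift, ← hc, add_mul, mul_neg, ← neg_add]
    rw [intervalIntegral.integral_neg, intervalIntegral.integral_add (hid _ _) ((hone _ _).const_mul c),
      intervalIntegral.integral_const_mul, integral_squareWave]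
    simp
  have h2 : ∫ u in (-c + 2 * Real.pi)..(2 * Real.pi), u * squareWave n u
      = (∫ u in (-c)..0, u * squareWave n u) + 2 * Real.pi * ∫ u in (-c)..0, squareWave n u := by
    have e : ∫ u in (-c + 2 * Real.pi)..(2 * Real.pi), u * squareWave n u
        = ∫ u in (-c)..0, (u + 2 * Real.pi) * squareWave n (u + 2 * Real.pi) := by
      rw [intervalIntegral.integral_comp_add_right (fun u => u * squareWave n u) (2 * Real.pi),
        zero_add]
    rw [e]
    simp_rw [squareWave_periodic n _, add_mul]
    rw [intervalIntegral.integral_add (hid _ _) ((hone _ _).const_mul _),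
      intervalIntegral.integral_const_mul]
  have h3 := intervalIntegral.integral_add_adjacent_intervals (hid (-c) 0) (hid 0 (2 * Real.pi))
  have h4 := intervalIntegral.integral_add_adjacent_intervals (hid (-c) (-c + 2 * Real.pi))
    (hid (-c + 2 * Real.pi) (2 * Real.pi))
  have h5 : |∫ u in (-c)..0, squareWave n u| ≤ c := by
    have := intervalIntegral.norm_integral_le_of_norm_le_const (a := -c) (b := 0) (C := 1)
      (f := squareWave n) fun u _ => abs_squareWave_le n u
    simpa [abs_of_nonneg hc0] using this
  have h6 : ∫ u in (0 : ℝ)..(2 * Real.pi), (Real.pi - u) / 2 * squareWave n u = -(1 / 2) * G := by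
    have e : ∀ u, (Real.pi - u) / 2 * squareWave n u
        = Real.pi / 2 * squareWave n u - 1 / 2 * (u * squareWave n u) := fun u => by ring
    simp_rw [e]
    have h0 := integral_squareWave n 0
    rw [zero_add] at h0
    rw [intervalIntegral.integral_sub ((hone _ _).const_mul _) ((hid _ _).const_mul _),
      intervalIntegral.integral_const_mul, intervalIntegral.integral_const_mul, h0]
    ring
  have h7 : Real.pi ^ 2 / (2 * ((n : ℝ) + 1)) = Real.pi * c / 2 := by rw [hc]; field_simp
  rw [h6, h7]
  have h8 : G = Real.pi * ∫ u in (-c)..0, squareWave n u := by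
    rw [h2] at h4; rw [← hG] at h3; linarith
  rw [h8]
  nlinarith [abs_le.1 h5, Real.pi_pos]

/-- Approximation of the sawtooth by trigonometric polynomials in the mean. -/
lemma exists_trigPoly_integral_saw_le (n : ℕ) : ∃ T ∈ trigPoly n,
    ∫ u in (0 : ℝ)..(2 * Real.pi), ‖(((Real.pi - u) / 2 : ℝ) : ℂ) - T (u : Circ)‖
      ≤ Real.pi ^ 2 / (2 * (n + 1)) := by
  obtain ⟨p, hp, hsign⟩ := exists_saw_interpolant n
  obtain ⟨T, hT, hTu⟩ := exists_trigPoly_sin_mul_eval_cos hp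
  refine ⟨T, hT, ?_⟩
  set q : ℝ → ℝ := fun u => Real.sin u * p.eval (Real.cos u) with hq
  have hqc : Continuous q := Real.continuous_sin.mul (p.continuous.comp Real.continuous_cos)
  set e : ℝ → ℝ := fun u => (Real.pi - u) / 2 - q u with he
  have hec : Continuous e := by fun_prop
  have hsign1 : ∀ u ∈ Set.Ioo 0 Real.pi, 0 ≤ e u * Real.sin (((n : ℝ) + 1) * u) := hsign
  -- Under `u ↦ 2π - u` both the error and the sine change sign, so their product is preserved.
  have hsign2 : ∀ u ∈ Set.Ioo 0 (2 * Real.pi), u ≠ Real.pi →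
      0 ≤ e u * Real.sin (((n : ℝ) + 1) * u) := by
    intro u hu hne
    rcases lt_or_gt_of_ne hne with h | h
    · exact hsign1 u ⟨hu.1, h⟩
    · have h1 := hsign1 (2 * Real.pi - u) ⟨by linarith [hu.2], by linarith⟩
      have h2 : ((n : ℝ) + 1) * (2 * Real.pi - u)
          = (n + 1 : ℕ) * (2 * Real.pi) - ((n : ℝ) + 1) * u := by push_cast; ring
      have h3 : e (2 * Real.pi - u) = -e u := by
        simp only [he, hq, Real.sin_two_pi_sub, Real.cos_two_pi_sub]; ring
      rw [h2, Real.sin_nat_mul_two_pi_sub, h3, neg_mul_neg] at h1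
      exact h1
  have habs : ∫ u in (0 : ℝ)..(2 * Real.pi), |e u|
      = ∫ u in (0 : ℝ)..(2 * Real.pi), e u * squareWave n u := by
    refine intervalIntegral.integral_congr_ae ?_
    -- The exceptional points: zeros of the sine, where the square wave is `0 / 0 = 0`, and the
    -- points not covered by `hsign2`.
    have hz : (Set.range (fun k : ℤ => (k : ℝ) * Real.pi / (n + 1)) ∪
        {Real.pi, 2 * Real.pi}).Countable :=
      (Set.countable_range _).union (by simp)
    filter_upwards [hz.ae_notMem MeasureTheory.volume] with u hu hu2
    rw [Set.uIoc_of_le (by positivity)] at hu2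
    simp only [Set.mem_union, Set.mem_range, Set.mem_insert_iff, Set.mem_singleton_iff,
      not_or, not_exists] at hu
    have h1 := hsign2 u ⟨hu2.1, lt_of_le_of_ne hu2.2 hu.2.2⟩ hu.2.1
    have h2 : Real.sin (((n : ℝ) + 1) * u) ≠ 0 := by
      intro h
      obtain ⟨k, hk⟩ := Real.sin_eq_zero_iff.1 h
      refine hu.1 k ?_
      rw [hk]; field_simp
    unfold squareWave
    rw [← mul_div_assoc, eq_div_iff (abs_ne_zero.2 h2), ← abs_mul, abs_of_nonneg h1]
  have h1 : ∀ u : ℝ, ‖(((Real.pi - u) / 2 : ℝ) : ℂ) - T (u : Circ)‖ = |e u| := by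
    intro u
    rw [hTu, ← Complex.ofReal_sub, Complex.norm_real, Real.norm_eq_abs]
  have h2 : ∫ u in (0 : ℝ)..(2 * Real.pi), q u * squareWave n u = 0 := by
    have := integral_trigPoly_mul_squareWave hT
    simp_rw [hTu, ← Complex.ofReal_mul] at this
    rw [intervalIntegral.integral_ofReal] at this
    exact_mod_cast this
  simp_rw [h1]
  rw [habs]
  simp_rw [he, sub_mul]
  rw [intervalIntegral.integral_sub
    (intervalIntegrable_mul_squareWave n (by fun_prop) _ _)
    (intervalIntegrable_mul_squareWave n hqc _ _), h2, sub_zero]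
  exact integral_saw_mul_squareWave_le n

/-! ### Best approximation as the quotient seminorm modulo `T_n` -/

lemma bestApprox_eq_norm_mkQ (n : ℕ) (f : C(Circ, ℂ)) :
    bestApprox n f = ‖(trigPoly n).mkQ f‖ := by
  have h : ‖(trigPoly n).mkQ f‖ = Metric.infDist f (trigPoly n : Set C(Circ, ℂ)) :=
    QuotientAddGroup.norm_mk (S := (trigPoly n).toAddSubgroup) f
  rw [h, Metric.infDist_eq_iInf]
  simp_rw [dist_eq_norm]
  rfl

lemma bestApprox_nonneg (n : ℕ) (f : C(Circ, ℂ)) : 0 ≤ bestApprox n f := by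
  rw [bestApprox_eq_norm_mkQ]; exact norm_nonneg _

lemma bestApprox_le_norm (n : ℕ) (f : C(Circ, ℂ)) : bestApprox n f ≤ ‖f‖ := by
  rw [bestApprox_eq_norm_mkQ]
  exact QuotientAddGroup.norm_mk_le_norm (S := (trigPoly n).toAddSubgroup)

lemma bestApprox_add_le (n : ℕ) (f g : C(Circ, ℂ)) :
    bestApprox n (f + g) ≤ bestApprox n f + bestApprox n g := by
  simp only [bestApprox_eq_norm_mkQ, map_add]; exact norm_add_le _ _

lemma bestApprox_sum_le {ι : Type*} (n : ℕ) (s : Finset ι) (f : ι → C(Circ, ℂ)) :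
    bestApprox n (∑ i ∈ s, f i) ≤ ∑ i ∈ s, bestApprox n (f i) := by
  simp only [bestApprox_eq_norm_mkQ, map_sum]; exact norm_sum_le _ _

lemma bestApprox_smul (n : ℕ) (c : ℂ) (f : C(Circ, ℂ)) :
    bestApprox n (c • f) = ‖c‖ * bestApprox n f := by
  simp only [bestApprox_eq_norm_mkQ, map_smul]; exact norm_smul _ _

lemma bestApprox_sub_of_mem {n : ℕ} {τ : C(Circ, ℂ)} (hτ : τ ∈ trigPoly n) (f : C(Circ, ℂ)) :
    bestApprox n (f - τ) = bestApprox n f := by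
  simp only [bestApprox_eq_norm_mkQ, map_sub, Submodule.mkQ_apply,
    (Submodule.Quotient.mk_eq_zero _).2 hτ, sub_zero]

/-! ### Translations and their integrals -/

/-- Translation `f ↦ f (· + u)`. -/
noncomputable def trans (u : ℝ) : C(Circ, ℂ) →L[ℂ] C(Circ, ℂ) :=
  LinearMap.mkContinuous
    { toFun := fun f => f.comp ⟨fun x => x + (u : Circ), by fun_prop⟩
      map_add' := fun _ _ => rfl
      map_smul' := fun _ _ => rfl } 1 fun f => by
    rw [one_mul, ContinuousMap.norm_le _ (norm_nonneg _)]
    exact fun x => f.norm_coe_le_norm _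

@[simp] lemma trans_apply (u : ℝ) (f : C(Circ, ℂ)) (x : Circ) : trans u f x = f (x + (u : Circ)) :=
  rfl

lemma norm_trans_le (u : ℝ) (f : C(Circ, ℂ)) : ‖trans u f‖ ≤ ‖f‖ := by
  rw [ContinuousMap.norm_le _ (norm_nonneg _)]
  exact fun x => f.norm_coe_le_norm _

lemma trans_trans (u v : ℝ) (f : C(Circ, ℂ)) : trans u (trans v f) = trans (u + v) f := by
  ext x
  simp [add_assoc]

lemma continuous_trans (f : C(Circ, ℂ)) : Continuous fun u => trans u f := by
  have hc : Continuous ((↑) : ℝ → Circ) := AddCircle.continuous_mk' _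
  let F : C(ℝ × Circ, ℂ) := ⟨fun p => f (p.2 + (p.1 : Circ)), by fun_prop⟩
  exact F.curry.continuous

lemma trans_periodic (f : C(Circ, ℂ)) :
    Function.Periodic (fun u => trans u f) (2 * Real.pi) := by
  intro u
  ext x
  simp only [trans_apply]
  rw [AddCircle.coe_add_period]

lemma trans_fourier (u : ℝ) (j : ℤ) :
    trans u (fourier j) = (fourier j : C(Circ, ℂ)) (u : Circ) • (fourier j : C(Circ, ℂ)) := by
  ext x
  simp [fourier_apply, smul_add, AddCircle.toCircle_add, mul_comm]

lemma intervalIntegral_apply {F : ℝ → C(Circ, ℂ)} (hF : Continuous F) (a b : ℝ) (x : Circ) :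
    (∫ u in a..b, F u) x = ∫ u in a..b, F u x :=
  ((ContinuousMap.evalCLM ℂ x).intervalIntegral_comp_comm (hF.intervalIntegrable a b)).symm

lemma continuous_coe_circ (T : C(Circ, ℂ)) : Continuous fun u : ℝ => T (u : Circ) :=
  T.continuous.comp (AddCircle.continuous_mk' _)

/-- For a single exponential, substituting `u + y` for `u` pulls `e^{-ijy}` out of the integral, and
`T_n` is symmetric under `j ↦ -j`. -/
lemma integral_smul_trans_mem {n : ℕ} {T : C(Circ, ℂ)} (hT : T ∈ trigPoly n) (f : C(Circ, ℂ)) :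
    ∫ u in (0 : ℝ)..(2 * Real.pi), T (u : Circ) • trans u f ∈ trigPoly n := by
  have hc : ∀ T : C(Circ, ℂ), Continuous fun u : ℝ => T (u : Circ) • trans u f := fun T =>
    (continuous_coe_circ T).smul (continuous_trans f)
  induction hT using Submodule.span_induction with
  | mem x h =>
    obtain ⟨j, hj, rfl⟩ := h
    have : ∫ u in (0 : ℝ)..(2 * Real.pi), (fourier j : C(Circ, ℂ)) (u : Circ) • trans u f
        = (∫ u in (0 : ℝ)..(2 * Real.pi), (fourier j : C(Circ, ℂ)) (u : Circ) * f (u : Circ)) •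
          (fourier (-j) : C(Circ, ℂ)) := by
      ext x
      induction x using QuotientAddGroup.induction_on with
      | H y =>
      rw [intervalIntegral_apply (hc _)]
      set G : ℝ → ℂ := fun u => (fourier j : C(Circ, ℂ)) (u : Circ) * f (u : Circ) with hG
      have hper : Function.Periodic G (2 * Real.pi) := by
        intro u
        simp only [hG]
        rw [AddCircle.coe_add_period]
      have h1 : ∀ u : ℝ, ((fourier j : C(Circ, ℂ)) (u : Circ) • trans u f) (y : Circ)
          = (fourier (-j) : C(Circ, ℂ)) (y : Circ) * G (u + y) := by
        intro u
        simp only [ContinuousMap.smul_apply, trans_apply, smul_eq_mul, hG, fourier_circ]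
        rw [← AddCircle.coe_add, add_comm u y, ← mul_assoc, ← Complex.exp_add]
        push_cast
        ring_nf
      rw [intervalIntegral.integral_congr fun u _ => h1 u, intervalIntegral.integral_const_mul,
        intervalIntegral.integral_comp_add_right, zero_add, add_comm (2 * Real.pi) y,
        hper.intervalIntegral_add_eq y 0, zero_add]
      simp only [ContinuousMap.smul_apply, smul_eq_mul, mul_comm]
    rw [this]
    exact Submodule.smul_mem _ _ (fourier_mem_trigPoly (by simpa using hj))
  | zero => simp
  | add x y _ _ hx hy =>
    simp only [ContinuousMap.add_apply, add_smul]
    rw [intervalIntegral.integral_add ((hc x).intervalIntegrable _ _)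
      ((hc y).intervalIntegrable _ _)]
    exact Submodule.add_mem _ hx hy
  | smul a x _ hx =>
    simp only [ContinuousMap.smul_apply, smul_eq_mul, mul_smul]
    rw [intervalIntegral.integral_smul]
    exact Submodule.smul_mem _ _ hx

lemma integral_trans_mem {n : ℕ} {τ : C(Circ, ℂ)} (hτ : τ ∈ trigPoly n) (a b : ℝ) :
    ∫ u in a..b, trans u τ ∈ trigPoly n := by
  induction hτ using Submodule.span_induction with
  | mem x h =>
    obtain ⟨j, hj, rfl⟩ := h
    simp_rw [trans_fourier]
    rw [intervalIntegral.integral_smul_const]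
    exact Submodule.smul_mem _ _ (fourier_mem_trigPoly hj)
  | zero => simp
  | add x y _ _ hx hy =>
    simp only [map_add]
    rw [intervalIntegral.integral_add ((continuous_trans x).intervalIntegrable _ _)
      ((continuous_trans y).intervalIntegrable _ _)]
    exact Submodule.add_mem _ hx hy
  | smul a x _ hx =>
    simp only [map_smul]
    rw [intervalIntegral.integral_smul]
    exact Submodule.smul_mem _ _ hx

/-! ### The Favard estimate -/

/-- A periodic curve is integrated over `[a, b]` by means of the sawtooth kernel. -/
lemma integral_eq_integral_saw {E : Type*} [NormedAddCommGroup E] [NormedSpace ℝ E]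
    [CompleteSpace E] {φ : ℝ → E} (hφ : Continuous φ) (hper : Function.Periodic φ (2 * Real.pi))
    (a b : ℝ) :
    Real.pi • ∫ u in a..b, φ u = ((b - a) / 2) • (∫ u in (0 : ℝ)..(2 * Real.pi), φ u) -
      ∫ u in (0 : ℝ)..(2 * Real.pi), ((Real.pi - u) / 2) • (φ (b + u) - φ (a + u)) := by
  set P : ℝ → E := fun x => ∫ u in (0 : ℝ)..x, φ u with hP
  set M : E := ∫ u in (0 : ℝ)..(2 * Real.pi), φ u with hM
  have hPd : ∀ x, HasDerivAt P (φ x) x := fun x =>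
    intervalIntegral.integral_hasDerivAt_right (hφ.intervalIntegrable _ _)
      hφ.aestronglyMeasurable.stronglyMeasurableAtFilter hφ.continuousAt
  have hPc : Continuous P := continuous_iff_continuousAt.2 fun x => (hPd x).continuousAt
  have hPper : ∀ x, P (x + 2 * Real.pi) = P x + M := by
    intro x
    simp only [hP, hM]
    rw [← intervalIntegral.integral_add_adjacent_intervals (hφ.intervalIntegrable 0 x)
      (hφ.intervalIntegrable x _), hper.intervalIntegral_add_eq x 0, zero_add]
  -- Integration by parts against the primitive `P`, which grows by the mean term `M` over each
  -- period.
  have hparts : ∀ b, ∫ u in (0 : ℝ)..(2 * Real.pi), ((Real.pi - u) / 2) • φ (b + u)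
      = -(Real.pi • P b) - (Real.pi / 2) • M + (1 / 2 : ℝ) • ∫ u in b..(b + 2 * Real.pi), P u := by
    intro b
    have hu : ∀ x ∈ Set.uIcc (0 : ℝ) (2 * Real.pi),
        HasDerivAt (fun u : ℝ => (Real.pi - u) / 2) (-(1 / 2)) x := by
      intro x _
      have := ((hasDerivAt_id x).const_sub Real.pi).div_const 2
      exact this.congr_deriv (by ring)
    have hv : ∀ x ∈ Set.uIcc (0 : ℝ) (2 * Real.pi),
        HasDerivAt (fun u : ℝ => P (b + u)) (φ (b + x)) x := by
      intro x _
      exact (hPd (b + x)).comp_const_add b x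
    have hφb : Continuous fun u => φ (b + u) := by fun_prop
    rw [intervalIntegral.integral_smul_deriv_eq_deriv_smul hu hv
      (by simp) (hφb.intervalIntegrable _ _), hPper b,
      intervalIntegral.integral_smul, intervalIntegral.integral_comp_add_left, add_zero]
    module
  have hφb : ∀ b, IntervalIntegrable (fun u => ((Real.pi - u) / 2) • φ (b + u))
      MeasureTheory.volume 0 (2 * Real.pi) := fun b =>
    Continuous.intervalIntegrable (by fun_prop) _ _
  -- The integral of `P` over a period window changes by `M` times the displacement of the window.
  have hdiff : (∫ u in b..(b + 2 * Real.pi), P u) - ∫ u in a..(a + 2 * Real.pi), P u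
      = (b - a) • M := by
    have h1 := intervalIntegral.integral_add_adjacent_intervals
      (hPc.intervalIntegrable (μ := MeasureTheory.volume) a b)
      (hPc.intervalIntegrable b (b + 2 * Real.pi))
    have h2 := intervalIntegral.integral_add_adjacent_intervals
      (hPc.intervalIntegrable (μ := MeasureTheory.volume) a (a + 2 * Real.pi))
      (hPc.intervalIntegrable (a + 2 * Real.pi) (b + 2 * Real.pi))
    have h3 : ∫ u in (a + 2 * Real.pi)..(b + 2 * Real.pi), P u
        = (∫ u in a..b, P u) + (b - a) • M := by
      rw [← intervalIntegral.integral_comp_add_right]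
      simp_rw [hPper]
      rw [intervalIntegral.integral_add (hPc.intervalIntegrable _ _) (by simp)]
      simp
    rw [h3, ← h1] at h2
    rw [sub_eq_iff_eq_add]
    rw [← add_assoc, add_comm _ (∫ u in a..b, P u), add_assoc] at h2
    rw [← add_left_cancel h2, add_comm]
  have hPab : ∫ u in a..b, φ u = P b - P a := by
    simp only [hP]
    rw [intervalIntegral.integral_interval_sub_left (hφ.intervalIntegrable _ _)
      (hφ.intervalIntegrable _ _)]
  simp_rw [smul_sub]
  rw [intervalIntegral.integral_sub (hφb b) (hφb a), hparts, hparts, hPab]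
  have hd2 := congrArg (fun z => (1 / 2 : ℝ) • z) hdiff
  simp only [smul_sub] at hd2
  rw [smul_smul] at hd2
  have : (b - a) / 2 = 1 / 2 * (b - a) := by ring
  rw [this, ← hd2]
  module

/-- The Favard type estimate for integrals of translates. -/
lemma bestApprox_integral_trans_le_norm (n : ℕ) (f : C(Circ, ℂ)) (a b : ℝ) :
    bestApprox n (∫ u in a..b, trans u f) ≤ Real.pi / (n + 1) * ‖f‖ := by
  obtain ⟨T, hT, hTint⟩ := exists_trigPoly_integral_saw_le n
  have hsaw := integral_eq_integral_saw (continuous_trans f) (trans_periodic f) a b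
  set D : ℝ → C(Circ, ℂ) := fun u => trans u (trans b f) - trans u (trans a f) with hD
  have hDc : Continuous D := (continuous_trans _).sub (continuous_trans _)
  have hDeq : ∀ u, trans (b + u) f - trans (a + u) f = D u := by
    intro u; simp only [hD, trans_trans, add_comm u]
  have hDle : ∀ u, ‖D u‖ ≤ 2 * ‖f‖ := by
    intro u
    rw [← hDeq]
    refine (norm_sub_le _ _).trans ?_
    linarith [norm_trans_le (b + u) f, norm_trans_le (a + u) f]
  simp_rw [hDeq] at hsaw
  have hM : ∫ u in (0 : ℝ)..(2 * Real.pi), trans u f ∈ trigPoly n := by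
    have := integral_smul_trans_mem (fourier_mem_trigPoly (n := n) (j := 0) (by simp)) f
    simpa using this
  have hTD : ∫ u in (0 : ℝ)..(2 * Real.pi), T (u : Circ) • D u ∈ trigPoly n := by
    have hc : ∀ g, IntervalIntegrable (fun u : ℝ => T (u : Circ) • trans u g)
        MeasureTheory.volume 0 (2 * Real.pi) := fun g =>
      ((continuous_coe_circ T).smul (continuous_trans g)).intervalIntegrable _ _
    simp only [hD, smul_sub]
    rw [intervalIntegral.integral_sub (hc _) (hc _)]
    exact Submodule.sub_mem _ (integral_smul_trans_mem hT _) (integral_smul_trans_mem hT _)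
  have hec : Continuous fun u : ℝ => (((Real.pi - u) / 2 : ℝ) : ℂ) - T (u : Circ) := by
    have := continuous_coe_circ T
    fun_prop
  set τ : C(Circ, ℂ) := (((b - a) / 2 : ℝ) : ℂ) • (∫ u in (0 : ℝ)..(2 * Real.pi), trans u f) -
    ∫ u in (0 : ℝ)..(2 * Real.pi), T (u : Circ) • D u with hτ
  have hτm : τ ∈ trigPoly n := Submodule.sub_mem _ (Submodule.smul_mem _ _ hM) hTD
  -- Replacing the sawtooth by its difference with `T` costs only elements of `T_n`, collected in
  -- `τ`.
  have herr : (Real.pi : ℂ) • (∫ u in a..b, trans u f) - τ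
      = -∫ u in (0 : ℝ)..(2 * Real.pi),
        ((((Real.pi - u) / 2 : ℝ) : ℂ) - T (u : Circ)) • D u := by
    simp_rw [sub_smul]
    rw [intervalIntegral.integral_sub, hτ, Complex.coe_smul, hsaw, Complex.coe_smul]
    · simp_rw [Complex.coe_smul]
      abel
    · exact Continuous.intervalIntegrable (by fun_prop) _ _
    · exact ((continuous_coe_circ T).smul hDc).intervalIntegrable _ _
  have hnorm : ‖(Real.pi : ℂ) • (∫ u in a..b, trans u f) - τ‖
      ≤ Real.pi ^ 2 / (2 * (n + 1)) * (2 * ‖f‖) := by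
    rw [herr, norm_neg]
    have h1 : ‖∫ u in (0 : ℝ)..(2 * Real.pi),
        ((((Real.pi - u) / 2 : ℝ) : ℂ) - T (u : Circ)) • D u‖ ≤
        ∫ u in (0 : ℝ)..(2 * Real.pi),
          ‖(((Real.pi - u) / 2 : ℝ) : ℂ) - T (u : Circ)‖ * (2 * ‖f‖) := by
      refine intervalIntegral.norm_integral_le_of_norm_le (by positivity) ?_
        (Continuous.intervalIntegrable (by fun_prop) _ _)
      refine Filter.Eventually.of_forall fun u _ => ?_
      rw [norm_smul]
      exact mul_le_mul_of_nonneg_left (hDle u) (norm_nonneg _)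
    refine h1.trans ?_
    rw [intervalIntegral.integral_mul_const]
    exact mul_le_mul_of_nonneg_right hTint (by positivity)
  have h2 := (bestApprox_le_norm n _).trans hnorm
  rw [bestApprox_sub_of_mem hτm, bestApprox_smul, Complex.norm_real, Real.norm_eq_abs,
    abs_of_pos Real.pi_pos] at h2
  have hpi := Real.pi_pos
  refine le_of_mul_le_mul_left (h2.trans_eq ?_) hpi
  field_simp

/-- Integrated translates of `τ ∈ T_n` stay in `T_n`, so the norm bound applies to `f - τ` for every
such `τ`. -/
lemma bestApprox_integral_trans_le (n : ℕ) (f : C(Circ, ℂ)) (a b : ℝ) :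
    bestApprox n (∫ u in a..b, trans u f) ≤ Real.pi / (n + 1) * bestApprox n f := by
  have hC : 0 ≤ Real.pi / ((n : ℝ) + 1) := by positivity
  have key : ∀ τ : trigPoly n, bestApprox n (∫ u in a..b, trans u f)
      ≤ Real.pi / (n + 1) * ‖f - (τ : C(Circ, ℂ))‖ := by
    intro τ
    have h1 := bestApprox_integral_trans_le_norm n (f - τ) a b
    simp only [map_sub] at h1
    rwa [intervalIntegral.integral_sub ((continuous_trans f).intervalIntegrable _ _)
      ((continuous_trans _).intervalIntegrable _ _),
      bestApprox_sub_of_mem (integral_trans_mem τ.2 a b)] at h1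
  unfold bestApprox at key ⊢
  rw [Real.mul_iInf_of_nonneg hC]
  exact le_ciInf key

/-! ### Averaged translates -/

/-- The mean of the translates `trans (j * u) g` over `|u| ≤ h / 2`. -/
noncomputable def avg (h j : ℝ) (g : C(Circ, ℂ)) : C(Circ, ℂ) :=
  (h : ℂ)⁻¹ • ∫ u in (-(h / 2))..(h / 2), trans (j * u) g

lemma avg_zero {h : ℝ} (hh : 0 < h) (g : C(Circ, ℂ)) : avg h 0 g = g := by
  have h0 : trans 0 g = g := by ext x; simp
  have hh' : (h : ℂ) ≠ 0 := by exact_mod_cast hh.ne'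
  simp only [avg, zero_mul, h0, intervalIntegral.integral_const, sub_neg_eq_add, add_halves]
  rw [← Complex.coe_smul, smul_smul, inv_mul_cancel₀ hh', one_smul]

lemma bestApprox_avg_le (n : ℕ) {h j : ℝ} (hh : 0 < h) (hj : j ≠ 0) (g : C(Circ, ℂ)) :
    bestApprox n (avg h j g) ≤ Real.pi / ((n + 1) * (|j| * h)) * bestApprox n g := by
  have hj' := abs_pos.2 hj
  unfold avg
  rw [intervalIntegral.integral_comp_mul_left (fun u => trans u g) hj, ← Complex.coe_smul,
    bestApprox_smul, bestApprox_smul]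
  have := bestApprox_integral_trans_le n g (j * -(h / 2)) (j * (h / 2))
  have h1 : ‖(h : ℂ)⁻¹‖ * (‖((j⁻¹ : ℝ) : ℂ)‖ *
      bestApprox n (∫ u in (j * -(h / 2))..(j * (h / 2)), trans u g)) ≤
      ‖(h : ℂ)⁻¹‖ * (‖((j⁻¹ : ℝ) : ℂ)‖ * (Real.pi / (n + 1) * bestApprox n g)) := by gcongr
  refine h1.trans_eq ?_
  rw [norm_inv, Complex.norm_real, Complex.norm_real, norm_inv, Real.norm_eq_abs, Real.norm_eq_abs,
    abs_of_pos hh]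
  field_simp

lemma bestApprox_avg_avg_le (n : ℕ) {h j : ℝ} (hh : 0 < h) (hj : j ≠ 0) (g : C(Circ, ℂ)) :
    bestApprox n (avg h j (avg h j g)) ≤
      (Real.pi / ((n + 1) * h)) ^ 2 * (1 / j ^ 2) * bestApprox n g := by
  have hj' := abs_pos.2 hj
  refine (bestApprox_avg_le n hh hj _).trans ?_
  refine (mul_le_mul_of_nonneg_left (bestApprox_avg_le n hh hj g) (by positivity)).trans_eq ?_
  rw [← sq_abs j]
  field_simp

/-! ### Central differences, moduli of smoothness and their averages -/

lemma norm_centralDiff_le (m : ℕ) (h : ℝ) (f : C(Circ, ℂ)) (x : Circ) :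
    ‖centralDiff m h f x‖ ≤ ∑ i ∈ Finset.range (m + 1), (m.choose i : ℝ) * ‖f‖ := by
  unfold centralDiff
  refine (norm_sum_le _ _).trans (Finset.sum_le_sum fun i _ => ?_)
  rw [norm_mul, norm_mul, norm_pow, norm_neg, norm_one, one_pow, one_mul, Complex.norm_natCast]
  exact mul_le_mul_of_nonneg_left (f.norm_coe_le_norm _) (Nat.cast_nonneg _)

lemma norm_centralDiff_le_modulus (m : ℕ) {h δ : ℝ} (hh : |h| < δ) (f : C(Circ, ℂ)) (x : Circ) :
    ‖centralDiff m h f x‖ ≤ modulus m f δ := by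
  refine le_csSup ⟨∑ i ∈ Finset.range (m + 1), (m.choose i : ℝ) * ‖f‖, ?_⟩ ⟨x, h, hh, rfl⟩
  rintro _ ⟨y, k, _, rfl⟩
  exact norm_centralDiff_le m k f y

lemma modulus_nonneg (m : ℕ) (f : C(Circ, ℂ)) (δ : ℝ) : 0 ≤ modulus m f δ := by
  refine Real.sSup_nonneg ?_
  rintro _ ⟨y, k, _, rfl⟩
  exact norm_nonneg _

lemma centralDiff_eq_fwdDiff (m : ℕ) (h : ℝ) (f : C(Circ, ℂ)) (x : Circ) :
    centralDiff m h f x =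
      (fwdDiff (h : Circ))^[m] f (x + ((-((m : ℝ) / 2) * h : ℝ) : Circ)) := by
  rw [fwdDiff_iter_eq_sum_shift]
  unfold centralDiff
  refine Finset.sum_congr rfl fun i _ => ?_
  rw [zsmul_eq_mul, add_assoc]
  congr 2
  · push_cast; rfl
  · rw [AddCircle.coe_add, ← nsmul_eq_mul, AddCircle.coe_nsmul]

lemma centralDiff_succ (m : ℕ) (h : ℝ) (f : C(Circ, ℂ)) (x : Circ) :
    centralDiff (m + 1) h f x = centralDiff m h f (x + ((h / 2 : ℝ) : Circ)) -
      centralDiff m h f (x + ((-(h / 2) : ℝ) : Circ)) := by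
  simp only [centralDiff_eq_fwdDiff, Function.iterate_succ_apply', fwdDiff, add_assoc,
    ← AddCircle.coe_add]
  congr 4 <;> push_cast <;> ring_nf

lemma modulus_succ_le (m : ℕ) (f : C(Circ, ℂ)) (δ : ℝ) :
    modulus (m + 1) f δ ≤ 2 * modulus m f δ := by
  refine Real.sSup_le ?_ (mul_nonneg zero_le_two (modulus_nonneg m f δ))
  rintro _ ⟨x, h, hh, rfl⟩
  rw [centralDiff_succ]
  refine (norm_sub_le _ _).trans ?_
  linarith [norm_centralDiff_le_modulus m hh f (x + ((h / 2 : ℝ) : Circ)),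
    norm_centralDiff_le_modulus m hh f (x + ((-(h / 2) : ℝ) : Circ))]

lemma norm_inv_smul_integral_le {E : Type*} [NormedAddCommGroup E] [NormedSpace ℂ E]
    {F : ℝ → E} {h C : ℝ} (hh : 0 < h) (hF : ∀ u, |u| ≤ h / 2 → ‖F u‖ ≤ C) :
    ‖(h : ℂ)⁻¹ • ∫ u in (-(h / 2))..(h / 2), F u‖ ≤ C := by
  have h1 : ‖∫ u in (-(h / 2))..(h / 2), F u‖ ≤ C * |h / 2 - -(h / 2)| := by
    refine intervalIntegral.norm_integral_le_of_norm_le_const fun u hu => hF u ?_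
    rw [Set.uIoc_of_le (by linarith)] at hu
    exact abs_le.2 ⟨hu.1.le, hu.2⟩
  rw [sub_neg_eq_add, add_halves, abs_of_pos hh] at h1
  rw [norm_smul, norm_inv, Complex.norm_real, Real.norm_eq_abs, abs_of_pos hh,
    inv_mul_le_iff₀ hh]
  linarith

/-- The double average of translates by `j_i u` and `j_i v` is an average of translates by `j_i (u +
v)` with one common `w = u + v`, `|w| ≤ h`; averaging does not increase a norm bound. -/
lemma norm_sum_smul_avg_avg_le {ι : Type*} (s : Finset ι) (c : ι → ℂ) (j : ι → ℝ) {h C : ℝ}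
    (hh : 0 < h) (f : C(Circ, ℂ))
    (hC : ∀ w, |w| ≤ h → ‖∑ i ∈ s, c i • trans (j i * w) f‖ ≤ C) :
    ‖∑ i ∈ s, c i • avg h (j i) (avg h (j i) f)‖ ≤ C := by
  have hcont : ∀ i, ∀ g : C(Circ, ℂ), Continuous fun u => c i • trans (j i * u) g := fun i g =>
    ((continuous_trans g).comp (continuous_const.mul continuous_id)).const_smul (c i)
  have hsum : ∀ g : ι → C(Circ, ℂ), ∑ i ∈ s, c i • avg h (j i) (g i)
      = (h : ℂ)⁻¹ • ∫ u in (-(h / 2))..(h / 2), ∑ i ∈ s, c i • trans (j i * u) (g i) := by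
    intro g
    rw [intervalIntegral.integral_finsetSum fun i _ => (hcont i (g i)).intervalIntegrable _ _,
      Finset.smul_sum]
    refine Finset.sum_congr rfl fun i _ => ?_
    rw [intervalIntegral.integral_smul, avg, smul_comm]
  rw [hsum]
  refine norm_inv_smul_integral_le hh fun u hu => ?_
  have htrans : ∑ i ∈ s, c i • trans (j i * u) (avg h (j i) f)
      = ∑ i ∈ s, c i • avg h (j i) (trans (j i * u) f) := by
    refine Finset.sum_congr rfl fun i _ => ?_
    have hc : Continuous fun v => trans (j i * v) f :=
      (continuous_trans f).comp (continuous_const.mul continuous_id)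
    rw [avg, map_smul, ← ContinuousLinearMap.intervalIntegral_comp_comm _
      (hc.intervalIntegrable _ _), avg]
    simp_rw [trans_trans, add_comm]
  rw [htrans, hsum]
  refine norm_inv_smul_integral_le hh fun v hv => ?_
  have := hC (v + u) ((abs_add_le v u).trans (by linarith))
  simpa only [trans_trans, ← mul_add] using this

/-! ### The inequality for even order -/

lemma sum_inv_sq_le (k : ℕ) :
    ∑ i ∈ Finset.range (2 * k + 1), 1 / ((i : ℝ) - k) ^ 2 ≤ Real.pi ^ 2 / 3 := by
  have hz : ∑ i ∈ Finset.range (k + 1), 1 / (i : ℝ) ^ 2 ≤ Real.pi ^ 2 / 6 :=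
    sum_le_hasSum _ (fun i _ => by positivity) hasSum_zeta_two
  -- The terms with denominator zero are `1 / 0 = 0`, so including the centre in a sum is harmless.
  have h1 : ∑ i ∈ Finset.range k, 1 / ((i : ℝ) - k) ^ 2
      = ∑ i ∈ Finset.range (k + 1), 1 / (i : ℝ) ^ 2 := by
    rw [← Finset.sum_range_reflect, Finset.sum_range_succ']
    simp only [CharP.cast_eq_zero, ne_eq, OfNat.ofNat_ne_zero, not_false_eq_true, zero_pow,
      div_zero, add_zero]
    refine Finset.sum_congr rfl fun i hi => ?_
    have hi' := Finset.mem_range.1 hi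
    rw [Nat.cast_sub (by omega), Nat.cast_sub (by omega)]
    push_cast
    ring_nf
  rw [show 2 * k + 1 = k + (k + 1) by ring, Finset.sum_range_add, h1]
  have h2 : ∑ i ∈ Finset.range (k + 1), 1 / (((k + i : ℕ) : ℝ) - k) ^ 2
      = ∑ i ∈ Finset.range (k + 1), 1 / (i : ℝ) ^ 2 := by
    refine Finset.sum_congr rfl fun i _ => ?_
    push_cast
    ring_nf
  rw [h2]
  linarith

lemma centralBinom_mul_bestApprox_le (k : ℕ) {n : ℕ} (hn : 1 ≤ n) (f : C(Circ, ℂ)) :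
    (k.centralBinom : ℝ) * bestApprox n f ≤ 13 * modulus (2 * k) f (2 * Real.pi / n) := by
  have hpi := Real.pi_pos
  have hn0 : (0 : ℝ) < n := by exact_mod_cast hn
  set δ : ℝ := 2 * Real.pi / n with hδ
  have hδ0 : 0 < δ := by positivity
  -- The modulus takes `|w| < δ` strictly, so `h` must be below `δ`; `19 / 20` still keeps the
  -- absorption constant in `hQle` below `1`.
  set h : ℝ := 19 / 20 * δ with hh
  have hh0 : 0 < h := by positivity
  set c : ℕ → ℂ := fun i => (-1 : ℂ) ^ (2 * k - i) * ((2 * k).choose i : ℂ) with hc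
  set j : ℕ → ℝ := fun i => (i : ℝ) - k with hj
  set E := bestApprox n f with hE
  have hE0 : 0 ≤ E := bestApprox_nonneg n f
  have hcn : ∀ i, ‖c i‖ = (2 * k).choose i := by
    intro i
    simp only [hc]
    rw [norm_mul, norm_pow, norm_neg, norm_one, one_pow, one_mul, Complex.norm_natCast]
  set W : C(Circ, ℂ) := ∑ i ∈ Finset.range (2 * k + 1), c i • avg h (j i) (avg h (j i) f) with hW
  have hWle : ‖W‖ ≤ modulus (2 * k) f δ := by
    refine norm_sum_smul_avg_avg_le _ _ _ hh0 f fun w hw => ?_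
    rw [ContinuousMap.norm_le _ (modulus_nonneg _ _ _)]
    intro x
    have : (∑ i ∈ Finset.range (2 * k + 1), c i • trans (j i * w) f) x
        = centralDiff (2 * k) w f x := by
      simp only [ContinuousMap.sum_apply, ContinuousMap.smul_apply, trans_apply, smul_eq_mul,
        centralDiff, hc, hj]
      refine Finset.sum_congr rfl fun i _ => ?_
      congr 4
      push_cast
      ring
    rw [this]
    exact norm_centralDiff_le_modulus _ (hw.trans_lt (by linarith)) f x
  have hk : k ∈ Finset.range (2 * k + 1) := Finset.mem_range.2 (by omega)
  -- The term `i = k` has step `0`, so averaging leaves it equal to `c k • f`.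
  have hsplit : c k • f = W + ∑ i ∈ (Finset.range (2 * k + 1)).erase k,
      (-c i) • avg h (j i) (avg h (j i) f) := by
    rw [hW, ← Finset.add_sum_erase _ _ hk]
    simp only [neg_smul, Finset.sum_neg_distrib]
    rw [add_neg_cancel_right]
    simp only [hj, sub_self, avg_zero hh0]
  set Q : ℝ := (Real.pi / ((n + 1) * h)) ^ 2 with hQ
  have hQ0 : 0 ≤ Q := by positivity
  have hrest : bestApprox n (∑ i ∈ (Finset.range (2 * k + 1)).erase k,
      (-c i) • avg h (j i) (avg h (j i) f)) ≤ k.centralBinom * (Q * E) * (Real.pi ^ 2 / 3) := by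
    refine (bestApprox_sum_le _ _ _).trans ?_
    have hterm : ∀ i ∈ (Finset.range (2 * k + 1)).erase k,
        bestApprox n ((-c i) • avg h (j i) (avg h (j i) f)) ≤
          k.centralBinom * (Q * E) * (1 / ((i : ℝ) - k) ^ 2) := by
      intro i hi
      have hik : j i ≠ 0 := by
        simp only [hj, sub_ne_zero]
        exact_mod_cast Finset.ne_of_mem_erase hi
      rw [bestApprox_smul, norm_neg, hcn]
      have h1 := bestApprox_avg_avg_le n hh0 hik f
      have h2 : (((2 * k).choose i : ℕ) : ℝ) ≤ k.centralBinom := by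
        exact_mod_cast Nat.choose_le_centralBinom i k
      refine (mul_le_mul h2 h1 (bestApprox_nonneg _ _) (Nat.cast_nonneg _)).trans_eq ?_
      ring
    refine (Finset.sum_le_sum hterm).trans ?_
    rw [← Finset.mul_sum]
    refine mul_le_mul_of_nonneg_left ?_ (by positivity)
    refine (Finset.sum_le_sum_of_subset_of_nonneg (Finset.erase_subset _ _)
      fun i _ _ => by positivity).trans (sum_inv_sq_le k)
  -- Since `n h = 19π / 10`, `Q ≤ (10 / 19)²`. The margin `1 - 23 / 25 = 2 / 25` gives the factor
  -- `25 / 2 ≤ 13`.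
  have hQle : Q * (Real.pi ^ 2 / 3) ≤ 23 / 25 := by
    have h1 : Real.pi / ((n + 1) * h) ≤ 10 / 19 := by
      rw [hh, hδ, div_le_div_iff₀ (by positivity) (by norm_num)]
      have : ((n : ℝ) + 1) * (19 / 20 * (2 * Real.pi / n)) = 19 / 10 * Real.pi * (1 + 1 / n) := by
        field_simp
        ring
      rw [this]
      have : 0 ≤ Real.pi * (1 / (n : ℝ)) := by positivity
      linarith
    have h2 : Q ≤ (10 / 19) ^ 2 := pow_le_pow_left₀ (by positivity) h1 2
    have h3 : Real.pi ^ 2 ≤ 3.15 ^ 2 := pow_le_pow_left₀ hpi.le Real.pi_lt_d2.le 2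
    nlinarith
  have hmain : (k.centralBinom : ℝ) * E ≤ modulus (2 * k) f δ +
      k.centralBinom * (Q * E) * (Real.pi ^ 2 / 3) := by
    have h1 : bestApprox n (c k • f) = k.centralBinom * E := by
      rw [bestApprox_smul, hcn, Nat.centralBinom]
    rw [← h1, hsplit]
    exact (bestApprox_add_le _ _ _).trans
      (add_le_add ((bestApprox_le_norm _ _).trans hWle) hrest)
  have hfin : (k.centralBinom : ℝ) * (Q * E) * (Real.pi ^ 2 / 3)
      ≤ 23 / 25 * (k.centralBinom * E) := by
    have : 0 ≤ (k.centralBinom : ℝ) * E := by positivity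
    nlinarith
  have := modulus_nonneg (2 * k) f δ
  linarith

lemma bestApprox_le_even {k : ℕ} (hk : 1 ≤ k) {n : ℕ} (hn : 1 ≤ n) (f : C(Circ, ℂ)) :
    bestApprox n f ≤ 13 * (2 * k) / 2 ^ (2 * k) * modulus (2 * k) f (2 * Real.pi / n) := by
  have h1 := centralBinom_mul_bestApprox_le k hn f
  have h2 : (4 : ℝ) ^ k ≤ 2 * k * k.centralBinom := by
    exact_mod_cast Nat.four_pow_le_two_mul_self_mul_centralBinom k hk
  have h3 := bestApprox_nonneg n f
  have h4 : (2 : ℝ) ^ (2 * k) = 4 ^ k := by rw [pow_mul]; norm_num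
  rw [h4, div_mul_eq_mul_div, le_div_iff₀ (by positivity)]
  calc bestApprox n f * 4 ^ k ≤ bestApprox n f * (2 * k * k.centralBinom) := by gcongr
    _ = 2 * k * (k.centralBinom * bestApprox n f) := by ring
    _ ≤ 2 * k * (13 * modulus (2 * k) f (2 * Real.pi / n)) := by gcongr
    _ = _ := by ring

/-! ### The Jackson–Stechkin constant -/

lemma mem_admissible {m : ℕ} (hm : 1 ≤ m) : 26 * (m : ℝ) / 2 ^ m ∈ admissible m := by
  intro f n hn
  have hn1 := hm.trans hn
  have hm' : (1 : ℝ) ≤ m := by exact_mod_cast hm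
  have hω := modulus_nonneg m f (2 * Real.pi / n)
  rcases Nat.even_or_odd' m with ⟨k, rfl | rfl⟩
  · refine (bestApprox_le_even (k := k) (by omega) hn1 f).trans ?_
    refine mul_le_mul_of_nonneg_right ?_ hω
    push_cast
    gcongr
    norm_num
  -- For odd `m`, passing to order `m + 1` gives `13 (m + 1) / 2^m`, at most `26 m / 2^m`.
  · have h1 := bestApprox_le_even (k := k + 1) (by omega) hn1 f
    have h2 := modulus_succ_le (2 * k + 1) f (2 * Real.pi / n)
    rw [show 2 * (k + 1) = 2 * k + 1 + 1 by ring] at h1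
    refine (h1.trans (mul_le_mul_of_nonneg_left h2 (by positivity))).trans ?_
    rw [← mul_assoc]
    refine mul_le_mul_of_nonneg_right ?_ hω
    rw [pow_succ _ (2 * k + 1), div_mul_eq_mul_div, div_le_div_iff₀ (by positivity) (by positivity)]
    have : (0 : ℝ) < 2 ^ (2 * k + 1) := by positivity
    push_cast
    nlinarith [mul_nonneg (Nat.cast_nonneg (α := ℝ) k) this.le]

/-- A test function with positive modulus excludes negative admissible constants, so the infimum is
a genuine one. For `h = π / m` the difference of `e^{it}` has modulus `|e^{ih} - 1|^m ≠ 0`. -/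
lemma modulus_fourier_one_pos {m : ℕ} (hm : 1 ≤ m) :
    0 < modulus m (fourier 1) (2 * Real.pi / m) := by
  have hm0 : (0 : ℝ) < m := by exact_mod_cast hm
  have hpi := Real.pi_pos
  set h : ℝ := Real.pi / m with hh
  have hlt : |h| < 2 * Real.pi / m := by
    rw [abs_of_pos (by positivity), hh]
    gcongr
    linarith
  refine lt_of_lt_of_le (norm_pos_iff.2 ?_) (norm_centralDiff_le_modulus m hlt (fourier 1) 0)
  have hsum : centralDiff m h (fourier 1) 0 = Complex.exp (Complex.I * (-((m : ℝ) / 2) * h : ℝ)) *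
      (Complex.exp (Complex.I * h) + -1) ^ m := by
    rw [add_pow, Finset.mul_sum]
    refine Finset.sum_congr rfl fun i _ => ?_
    rw [zero_add, fourier_circ, ← Complex.exp_nat_mul]
    push_cast
    rw [mul_add, Complex.exp_add, show Complex.I * 1 * (i * (h : ℂ)) = i * (Complex.I * h) by ring,
      mul_one]
    ring
  rw [hsum]
  refine mul_ne_zero (Complex.exp_ne_zero _) (pow_ne_zero _ fun h0 => ?_)
  have h1 : Complex.exp (Complex.I * h) = 1 := by linear_combination h0
  obtain ⟨k, hk⟩ := Complex.exp_eq_one_iff.1 h1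
  have hpi' : (Real.pi : ℂ) ≠ 0 := by exact_mod_cast hpi.ne'
  have hm' : (m : ℂ) ≠ 0 := by exact_mod_cast hm0.ne'
  have hI := Complex.I_ne_zero
  have h2 : (1 : ℂ) = 2 * (k * m) := by
    rw [hh] at hk
    push_cast at hk
    field_simp at hk
    linear_combination hk
  have h3 : (1 : ℤ) = 2 * (k * m) := by exact_mod_cast h2
  omega

lemma nonneg_of_mem_admissible {m : ℕ} (hm : 1 ≤ m) {J : ℝ} (hJ : J ∈ admissible m) : 0 ≤ J :=
  nonneg_of_mul_nonneg_left ((bestApprox_nonneg _ _).trans (hJ (fourier 1) m le_rfl))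
    (modulus_fourier_one_pos hm)

lemma bddBelow_admissible {m : ℕ} (hm : 1 ≤ m) : BddBelow (admissible m) :=
  ⟨0, fun _ hJ => nonneg_of_mem_admissible hm hJ⟩

/-- An intersection of closed conditions on `J`; hence the infimum is attained. -/
lemma isClosed_admissible (m : ℕ) : IsClosed (admissible m) := by
  simp only [admissible, Set.ofPred_forall]
  exact isClosed_iInter fun f => isClosed_iInter fun n => isClosed_iInter fun _ =>
    isClosed_le continuous_const (continuous_id.mul continuous_const)

lemma isLeast_jacksonConst {m : ℕ} (hm : 1 ≤ m) : IsLeast (admissible m) (jacksonConst m) :=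
  (isClosed_admissible m).isLeast_csInf ⟨_, mem_admissible hm⟩ (bddBelow_admissible hm)

lemma jacksonConst_nonneg {m : ℕ} (hm : 1 ≤ m) : 0 ≤ jacksonConst m :=
  nonneg_of_mem_admissible hm (isLeast_jacksonConst hm).1

lemma jacksonConst_le {m : ℕ} (hm : 1 ≤ m) : jacksonConst m ≤ 26 * (m : ℝ) / 2 ^ m :=
  (isLeast_jacksonConst hm).2 (mem_admissible hm)

lemma jacksonConst_le_geometric {m : ℕ} (hm : 1 ≤ m) :
    jacksonConst m ≤ 52 * (3 / 4 : ℝ) ^ m := by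
  refine (jacksonConst_le hm).trans ?_
  -- Bernoulli's inequality: `m / 2 ≤ (3 / 2)^m`, which absorbs the linear factor.
  have h1 := one_add_mul_le_pow (a := (1 / 2 : ℝ)) (by norm_num) m
  have h2 : (3 / 4 : ℝ) ^ m = (1 + 1 / 2) ^ m / 2 ^ m := by
    rw [← div_pow]; norm_num
  rw [h2, ← mul_div_assoc]
  exact div_le_div_of_nonneg_right (by linarith) (by positivity)

lemma jacksonConst_le_rpow {m : ℕ} (hm : 1 ≤ m) :
    jacksonConst m ≤ 26 * (2 : ℝ) ^ (-(m : ℝ) + (5 / 2 : ℝ) * Real.logb 2 (m : ℝ)) := by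
  refine (jacksonConst_le hm).trans ?_
  have hm' : (1 : ℝ) ≤ m := by exact_mod_cast hm
  have h1 : 0 ≤ Real.logb 2 (m : ℝ) := Real.logb_nonneg one_lt_two hm'
  have h2 : (2 : ℝ) ^ (-(m : ℝ) + Real.logb 2 (m : ℝ)) = m / 2 ^ m := by
    rw [Real.rpow_add two_pos, Real.rpow_neg zero_le_two, Real.rpow_natCast,
      Real.rpow_logb two_pos (by norm_num) (by linarith)]
    ring
  -- The bound holds with exponent `1` in place of `5 / 2`, and `logb 2 m ≥ 0`.
  rw [mul_div_assoc, ← h2]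
  gcongr
  · norm_num
  · linarith

end JacksonStechkin

theorem mainTheorem2 :
    (∀ m : ℕ, 1 ≤ m →
      IsLeast (JacksonStechkin.admissible m) (JacksonStechkin.jacksonConst m)) ∧
    (∃ C : ℝ, ∀ m : ℕ, 1 ≤ m →
      JacksonStechkin.jacksonConst m ≤
        C * (2 : ℝ) ^ (-(m : ℝ) + (5 / 2 : ℝ) * Real.logb 2 (m : ℝ))) ∧
    Tendsto JacksonStechkin.jacksonConst atTop (𝓝 0) ∧
    (∃ A q : ℝ, 0 < q ∧ q < 1 ∧ ∀ m : ℕ, 1 ≤ m →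
      JacksonStechkin.jacksonConst m ≤ A * q ^ m) := by
  refine ⟨fun m hm => JacksonStechkin.isLeast_jacksonConst hm,
    ⟨26, fun m hm => JacksonStechkin.jacksonConst_le_rpow hm⟩, ?_,
    ⟨52, 3 / 4, by norm_num, by norm_num, fun m hm =>
      JacksonStechkin.jacksonConst_le_geometric hm⟩⟩
  have h : Tendsto (fun m : ℕ => 52 * (3 / 4 : ℝ) ^ m) atTop (𝓝 0) := by
    simpa using (tendsto_pow_atTop_nhds_zero_of_lt_one (r := (3 / 4 : ℝ)) (by norm_num)
      (by norm_num)).const_mul 52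
  refine tendsto_of_tendsto_of_tendsto_of_le_of_le' tendsto_const_nhds h ?_ ?_
  · filter_upwards [eventually_ge_atTop 1] with m hm
    exact JacksonStechkin.jacksonConst_nonneg hm
  · filter_upwards [eventually_ge_atTop 1] with m hm
    exact JacksonStechkin.jacksonConst_le_geometric hm
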